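/- Consider $m$ infinite rays with common origin $O$. An instance $I$ consists of a value $W\ge 0$ and, for each ray $i$, a pair $(d_i,w_i)$ with $1\le d_i\le\infty$ and $w_i\ge 0$: a target of weight $w_i$ lies on ray $i$ at distance $d_i$ from $O$ ($d_i=\infty$ means that there is no target on ray $i$). It is required that $\sum_{i:\,d_i<\infty}w_i\ge W$. A deterministic search strategy starts at $O$; whenever it is at $O$ it chooses, as a function of its past excursions and of the distances and weights of the targets found in them, a ray $r$ and a finite depth $\ell$. The searcher walks along $r$ up to depth $\ell$ and returns to $O$; if it meets the target of $r$ on the way, it returns at once and never traverses $r$ again. The cost $c(\Sigma,I)$ of a strategy $\Sigma$ on $I$ is the total distance traversed until targets of aggregate weight at least $W$ have been found for the first time ($\infty$ if this never happens). In the partial information model, the offline algorithm knows $m$, $W$ and the multiset $\Lambda=\{(d_i,w_i)\}_i$, but not its presentation, i.e. the bijection that assigns the pairs to the rays. The offline cost (intrinsic cost) is $$\xi(W,\Lambda)=\inf_{\Sigma}\ \max_{I'}\ c(\Sigma,I'),$$ where $\Sigma$ ranges over all deterministic strategies (chosen with knowledge of $W$ and $\Lambda$) and $I'$ over all instances with value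 $W$ that are presentations of $\Lambda$. A deterministic online algorithm on $m$ rays assigns a deterministic strategy to every value $W$ (it may depend on $W$, but not on $\Lambda$). It is $\rho$-competitive, $\rho\ge 1$, if its cost is at most $\rho\cdot\xi$ on every instance, and its competitive ratio is the supremum over all instances of its cost divided by $\xi$ (with $0/0=0$, for $W=0$). Then there are absolute constants $c,C>0$ such that for every $m\ge 2$: 1. there is a deterministic search strategy on $m$ rays (not even depending on $W$) that is $(C\log m)$-competitive in the partial information model; 2. every deterministic online algorithm on $m$ rays has competitive ratio at least $c\log m$ in the partial information model. In particular, the optimal deterministic competitive ratio in this model is $\Theta(\log m)$. -/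

import Mathlib

open scoped NNReal ENNReal

noncomputable section

namespace WeightedSearch

/-- An instance on `m` rays: the weight `W` to be collected, and for every ray `i` the distance
`d i` and the weight `w i` of its target; `d i = ∞` means that there is no target on ray `i`.
The targets that exist have total weight at least `W`. -/
structure Instance (m : ℕ) where
  W : ℝ≥0
  d : Fin m → ℝ≥0∞
  w : Fin m → ℝ≥0
  one_le_d : ∀ i, 1 ≤ d i
  feasible : W ≤ ∑ i with d i ≠ ∞, w i

/-- The presentation of the multiset of pairs `(d i, w i)` that puts the pair of index `π i`
on ray `i`. -/
def Instance.present {m : ℕ} (I : Instance m) (π : Equiv.Perm (Fin m)) : Instance m where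
  W := I.W
  d := fun i => I.d (π i)
  w := fun i => I.w (π i)
  one_le_d := fun i => I.one_le_d (π i)
  feasible := by
    refine I.feasible.trans (le_of_eq ?_)
    rw [Finset.sum_filter, Finset.sum_filter]
    exact (Equiv.sum_comp π (fun i => if I.d i ≠ ∞ then I.w i else 0)).symm

/-- One excursion from the origin, as recorded by the searcher: the ray, the depth to which it was
to be searched, and the distance and weight of the target, if one was found. -/
structure Step (m : ℕ) where
  ray : Fin m
  depth : ℝ≥0
  seen : Option (ℝ≥0 × ℝ≥0)

/-- Length of the outbound leg of an excursion. -/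
def Step.out {m : ℕ} (s : Step m) : ℝ≥0 :=
  match s.seen with
  | some (x, _) => x
  | none => s.depth

/-- Weight collected in an excursion. -/
def Step.weight {m : ℕ} (s : Step m) : ℝ≥0 :=
  match s.seen with
  | some (_, y) => y
  | none => 0

/-- What the searcher knows when it is at the origin: its past excursions, the latest first. -/
abbrev History (m : ℕ) := List (Step m)

/-- A deterministic strategy with memory: at the origin, the next ray and the depth. -/
abbrev Strategy (m : ℕ) := History m → Fin m × ℝ≥0

/-- The target on ray `r` has already been found. -/
def History.Cleared {m : ℕ} (h : History m) (r : Fin m) : Prop :=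
  ∃ s ∈ h, s.ray = r ∧ s.seen.isSome

/-- Aggregate weight of the targets found. -/
def History.gathered {m : ℕ} (h : History m) : ℝ≥0 := (h.map Step.weight).sum

/-- Distance traversed when the searcher is back at the origin. -/
def History.traveled {m : ℕ} (h : History m) : ℝ≥0 := (h.map fun s => 2 * s.out).sum

/-- Distance traversed up to the end of the outbound leg of the latest excursion. -/
def History.elapsed {m : ℕ} : History m → ℝ≥0
  | [] => 0
  | s :: h => History.traveled h + s.out

open scoped Classical in
/-- The excursion that the strategy makes after history `h`. The searcher turns back at depth `ℓ`,
or earlier if it meets the target. A ray whose target was found is never traversed again: choosing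
it amounts to choosing depth `0`. -/
def nextStep {m : ℕ} (σ : Strategy m) (I : Instance m) (h : History m) : Step m :=
  let r := (σ h).1
  let ℓ : ℝ≥0 := if History.Cleared h r then 0 else (σ h).2
  { ray := r
    depth := ℓ
    seen := if I.d r ≤ (ℓ : ℝ≥0∞) then some ((I.d r).toNNReal, I.w r) else none }

/-- The history after `n` excursions. -/
def run {m : ℕ} (σ : Strategy m) (I : Instance m) : ℕ → History m
  | 0 => []
  | n + 1 => nextStep σ I (run σ I n) :: run σ I n

/-- The total distance traversed until targets of aggregate weight at least `W` have been found
(`∞` if this never happens). As `elapsed` is nondecreasing along a run, the infimum is attained the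
first time that the weight is reached. -/
def cost {m : ℕ} (σ : Strategy m) (I : Instance m) : ℝ≥0∞ :=
  ⨅ (n : ℕ) (_ : I.W ≤ History.gathered (run σ I n)),
    ((History.elapsed (run σ I n) : ℝ≥0) : ℝ≥0∞)

/-- The intrinsic cost: the offline algorithm knows `W` and the multiset of pairs `(d i, w i)`, but
not its presentation, and pays the worst case over all presentations. -/
def intrinsicCost {m : ℕ} (I : Instance m) : ℝ≥0∞ :=
  ⨅ σ : Strategy m, ⨆ π : Equiv.Perm (Fin m), cost σ (I.present π)

/-- A deterministic online algorithm, which may use the value `W`. -/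
abbrev Algorithm (m : ℕ) := ℝ≥0 → Strategy m

/-- `A` is `ρ`-competitive in the partial information model. -/
def IsCompetitive {m : ℕ} (A : Algorithm m) (ρ : ℝ) : Prop :=
  1 ≤ ρ ∧ ∀ I : Instance m, cost (A I.W) I ≤ ENNReal.ofReal ρ * intrinsicCost I

/-- The competitive ratio in the partial information model. (If `W = 0`, both costs are `0`, and
the quotient counts as `0`.) -/
def competitiveRatio {m : ℕ} (A : Algorithm m) : ℝ≥0∞ :=
  ⨆ I : Instance m, cost (A I.W) I / intrinsicCost I

end WeightedSearch

end

open scoped Classical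

noncomputable section

namespace WeightedSearch

/-! Upper bound. Call a set `F` of targets a decoy for `B` if it is too light and an adversary who
reveals only targets of `F` can keep all others out of reach of any searcher with effort at most
`B`. Against a given strategy the adversary permutes the hidden targets during the run, altering
nothing already seen, and keeps every unfound target of `F` beyond all depths explored in vain.
Hall's theorem supplies each permutation: a set of rays is constrained by the shallowest of them, so
counting targets beyond one threshold suffices. Hence a decoy for `B` forces intrinsic cost at least
`B` (`Decoy.le_intrinsicCost`).

`dovetail` always serves the smallest budget `2 ^ k` for which some ray is still to be explored.
When nothing is due for `2 ^ K`, either enough weight was found or the found targets are a decoy for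
`2 ^ K / 4`. Until then each dyadic class of depths costs `O(2 ^ K)`, and a class at depth `2 ^ i`
at most `O(m * 2 ^ i)`; only the top `O(log m)` classes matter, so the effort is `O(2 ^ K * log m)`.

Lower bound. Let the algorithm search where nothing is found, then put a target of full weight just
beyond the explored depth on every ray. If the depths sum to at most `T`, some rank `j` has at most
`j` depths above `T / ((j + 1) * H_m)`, so blindly sweeping `j + 1` rays to about that depth costs
only `O(T / H_m)`. -/

variable {m : ℕ}

/-! ### Bookkeeping for histories and runs -/

/-- The deepest point explored on ray `r`. -/
def History.reach : History m → Fin m → ℝ≥0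
  | [], _ => 0
  | s :: h, r => if s.ray = r then max s.out (History.reach h r) else History.reach h r

/-- The total length of the outbound legs. -/
def History.effort (h : History m) : ℝ≥0 := (h.map Step.out).sum

@[simp] theorem effort_nil : History.effort ([] : History m) = 0 := rfl

@[simp] theorem effort_cons (s : Step m) (h : History m) :
    History.effort (s :: h) = s.out + History.effort h := by
  simp [History.effort]

@[simp] theorem gathered_cons (s : Step m) (h : History m) :
    History.gathered (s :: h) = s.weight + History.gathered h := by
  simp [History.gathered]

theorem traveled_eq (h : History m) : History.traveled h = 2 * History.effort h := by
  simp [History.traveled, History.effort, List.sum_map_mul_left]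

/-- Together with the next bound this makes cost and outbound effort equal up to a factor 2, so all
later estimates concern effort only. -/
theorem effort_le_elapsed (h : History m) : History.effort h ≤ History.elapsed h := by
  cases h with
  | nil => simp [History.elapsed]
  | cons s h =>
    rw [effort_cons, History.elapsed, traveled_eq, two_mul, add_comm s.out]
    gcongr
    exact le_self_add

theorem elapsed_le_two_mul_effort (h : History m) : History.elapsed h ≤ 2 * History.effort h := by
  cases h with
  | nil => simp [History.elapsed]
  | cons s h =>
    rw [effort_cons, History.elapsed, traveled_eq, mul_add, add_comm, two_mul s.out]
    gcongr
    exact le_self_add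

@[simp] theorem not_cleared_nil (r : Fin m) : ¬ History.Cleared ([] : History m) r := by
  simp [History.Cleared]

theorem cleared_cons (s : Step m) (h : History m) (r : Fin m) :
    History.Cleared (s :: h) r ↔ (s.ray = r ∧ s.seen.isSome) ∨ History.Cleared h r := by
  simp [History.Cleared]

theorem sum_reach_le_effort (h : History m) : ∑ r, h.reach r ≤ h.effort := by
  induction h with
  | nil => simp [History.reach]
  | cons s h ih =>
    rw [effort_cons]
    calc ∑ r, History.reach (s :: h) r
        ≤ ∑ r, ((if s.ray = r then s.out else 0) + History.reach h r) := by
          refine Finset.sum_le_sum fun r _ => ?_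
          rw [History.reach]
          split_ifs
          · exact max_le le_self_add le_add_self
          · simp
      _ ≤ _ := by rw [Finset.sum_add_distrib]; simpa using ih

theorem reach_le_effort (h : History m) (r : Fin m) : h.reach r ≤ h.effort :=
  (Finset.single_le_sum (f := fun r => h.reach r) (fun _ _ => zero_le) (Finset.mem_univ r)).trans
    (sum_reach_le_effort h)

/-- The depth to which `σ` sends the searcher after history `h`. -/
def target (σ : Strategy m) (h : History m) : ℝ≥0 :=
  if History.Cleared h (σ h).1 then 0 else (σ h).2

@[simp] theorem nextStep_ray (σ : Strategy m) (I : Instance m) (h : History m) :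
    (nextStep σ I h).ray = (σ h).1 := rfl

@[simp] theorem nextStep_depth (σ : Strategy m) (I : Instance m) (h : History m) :
    (nextStep σ I h).depth = target σ h := rfl

theorem nextStep_found {σ : Strategy m} {I : Instance m} {h : History m}
    (hd : I.d (σ h).1 ≤ target σ h) :
    nextStep σ I h = ⟨(σ h).1, target σ h, some ((I.d (σ h).1).toNNReal, I.w (σ h).1)⟩ := by
  unfold nextStep
  simp only [target] at hd ⊢
  rw [if_pos hd]

theorem nextStep_missed {σ : Strategy m} {I : Instance m} {h : History m}
    (hd : (target σ h : ℝ≥0∞) < I.d (σ h).1) :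
    nextStep σ I h = ⟨(σ h).1, target σ h, none⟩ := by
  unfold nextStep
  simp only [target] at hd ⊢
  rw [if_neg hd.not_ge]

/-- A cleared ray is searched to depth 0, and every target is at distance at least 1. -/
theorem not_cleared_of_found {σ : Strategy m} {I : Instance m} {h : History m}
    (hd : I.d (σ h).1 ≤ target σ h) : ¬ History.Cleared h (σ h).1 := by
  intro hc
  rw [target, if_pos hc] at hd
  have := (I.one_le_d (σ h).1).trans hd
  simp at this

theorem out_nextStep_le (σ : Strategy m) (I : Instance m) (h : History m) :
    (nextStep σ I h).out ≤ target σ h := by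
  rcases le_or_gt (I.d (σ h).1) (target σ h) with hd | hd
  · rw [nextStep_found hd]
    simpa [Step.out] using ENNReal.toNNReal_mono ENNReal.coe_ne_top hd
  · rw [nextStep_missed hd]
    exact le_rfl

theorem run_succ (σ : Strategy m) (I : Instance m) (n : ℕ) :
    run σ I (n + 1) = nextStep σ I (run σ I n) :: run σ I n := rfl

/-- A history that records truthfully what is to be seen on `I`. -/
structure Faithful (I : Instance m) (h : History m) : Prop where
  uncleared : ∀ r, ¬ h.Cleared r → (h.reach r : ℝ≥0∞) < I.d r
  cleared : ∀ r, h.Cleared r → (h.reach r : ℝ≥0∞) = I.d r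
  gathered : h.gathered = ∑ r with h.Cleared r, I.w r

theorem cleared_found {σ : Strategy m} {I : Instance m} {h : History m}
    (hd : I.d (σ h).1 ≤ target σ h) (r : Fin m) :
    History.Cleared (nextStep σ I h :: h) r ↔ r = (σ h).1 ∨ History.Cleared h r := by
  rw [cleared_cons, nextStep_found hd]
  simp [eq_comm]

theorem cleared_missed {σ : Strategy m} {I : Instance m} {h : History m}
    (hd : (target σ h : ℝ≥0∞) < I.d (σ h).1) (r : Fin m) :
    History.Cleared (nextStep σ I h :: h) r ↔ History.Cleared h r := by
  rw [cleared_cons, nextStep_missed hd]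
  simp

theorem reach_nextStep_of_ne {σ : Strategy m} {I : Instance m} {h : History m} {r : Fin m}
    (hr : r ≠ (σ h).1) : History.reach (nextStep σ I h :: h) r = h.reach r := by
  rw [History.reach, nextStep_ray, if_neg hr.symm]

theorem reach_missed {σ : Strategy m} {I : Instance m} {h : History m}
    (hd : (target σ h : ℝ≥0∞) < I.d (σ h).1) :
    History.reach (nextStep σ I h :: h) (σ h).1 = max (target σ h) (h.reach (σ h).1) := by
  rw [History.reach, nextStep_missed hd]
  simp [Step.out]

theorem Faithful.reach_found {σ : Strategy m} {I : Instance m} {h : History m}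
    (H : Faithful I h) (hd : I.d (σ h).1 ≤ target σ h) :
    History.reach (nextStep σ I h :: h) (σ h).1 = (I.d (σ h).1).toNNReal := by
  rw [History.reach, nextStep_found hd]
  simp only [Step.out, if_true]
  refine max_eq_left ?_
  have := H.uncleared _ (not_cleared_of_found hd)
  rw [← ENNReal.coe_le_coe, ENNReal.coe_toNNReal (ne_top_of_le_ne_top ENNReal.coe_ne_top hd)]
  exact this.le

theorem Faithful.next {σ : Strategy m} {I : Instance m} {h : History m} (H : Faithful I h) :
    Faithful I (nextStep σ I h :: h) := by
  rcases le_or_gt (I.d (σ h).1) (target σ h) with hd | hd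
  · have hn := not_cleared_of_found hd
    refine ⟨fun r hr => ?_, fun r hr => ?_, ?_⟩
    · rw [cleared_found hd, not_or] at hr
      rw [reach_nextStep_of_ne hr.1]
      exact H.uncleared r hr.2
    · by_cases e : r = (σ h).1
      · subst e
        rw [H.reach_found hd, ENNReal.coe_toNNReal (ne_top_of_le_ne_top ENNReal.coe_ne_top hd)]
      · rw [reach_nextStep_of_ne e]
        rw [cleared_found hd] at hr
        exact H.cleared r (hr.resolve_left e)
    · have : (Finset.univ.filter fun r => History.Cleared (nextStep σ I h :: h) r)
          = insert (σ h).1 (Finset.univ.filter fun r => History.Cleared h r) := by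
        ext r
        simp [cleared_found hd]
      rw [this, Finset.sum_insert (by simpa using hn), gathered_cons, H.gathered,
        nextStep_found hd]
      rfl
  · refine ⟨fun r hr => ?_, fun r hr => ?_, ?_⟩
    · rw [cleared_missed hd] at hr
      by_cases e : r = (σ h).1
      · subst e
        rw [reach_missed hd, ENNReal.coe_max]
        exact max_lt hd (H.uncleared _ hr)
      · rw [reach_nextStep_of_ne e]
        exact H.uncleared r hr
    · rw [cleared_missed hd] at hr
      by_cases e : r = (σ h).1
      · subst e
        rw [reach_missed hd, target, if_pos hr]
        simpa using H.cleared _ hr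
      · rw [reach_nextStep_of_ne e]
        exact H.cleared r hr
    · simp only [cleared_missed hd]
      rw [gathered_cons, H.gathered, nextStep_missed hd]
      simp [Step.weight]

theorem faithful_run (σ : Strategy m) (I : Instance m) (n : ℕ) : Faithful I (run σ I n) := by
  induction n with
  | zero =>
    refine ⟨fun r _ => ?_, fun r hr => absurd hr (not_cleared_nil r), ?_⟩
    · simpa [run, History.reach] using zero_lt_one.trans_le (I.one_le_d r)
    · simp [run, History.gathered]
  | succ n ih => exact ih.next

theorem Cleared.mono_run {σ : Strategy m} {I : Instance m} {n n' : ℕ} (hn : n ≤ n') {r : Fin m}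
    (hr : History.Cleared (run σ I n) r) : History.Cleared (run σ I n') r := by
  induction n', hn using Nat.le_induction with
  | base => exact hr
  | succ k _ ih => exact (cleared_cons _ _ _).2 (Or.inr ih)

theorem effort_run_mono (σ : Strategy m) (I : Instance m) :
    Monotone fun n => (run σ I n).effort :=
  monotone_nat_of_le_succ fun n => by
    rw [run_succ, effort_cons]
    exact le_add_self

theorem reach_run_mono (σ : Strategy m) (I : Instance m) (r : Fin m) :
    Monotone fun n => (run σ I n).reach r :=
  monotone_nat_of_le_succ fun n => by
    simp only [run_succ, History.reach]
    split_ifs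
    · exact le_max_right _ _
    · exact le_rfl

/-- A run does not change if the instance is altered where it has not been explored. -/
theorem run_congr {σ : Strategy m} {I J : Instance m} {n : ℕ}
    (hc : ∀ r, History.Cleared (run σ I n) r → J.d r = I.d r ∧ J.w r = I.w r)
    (hu : ∀ r, ¬ History.Cleared (run σ I n) r → ((run σ I n).reach r : ℝ≥0∞) < J.d r) :
    ∀ k ≤ n, run σ J k = run σ I k := by
  intro k
  induction k with
  | zero => intro _; rfl
  | succ k ih =>
    intro hk
    have e := ih (Nat.le_of_succ_le hk)
    rw [run_succ, run_succ, e]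
    congr 1
    by_cases hcl : History.Cleared (run σ I n) (σ (run σ I k)).1
    · obtain ⟨h1, h2⟩ := hc _ hcl
      unfold nextStep
      simp only [h1, h2]
    · have h1 := (faithful_run σ I n).uncleared _ hcl
      have h2 := hu _ hcl
      have hm : (target σ (run σ I k) : ℝ≥0∞) < I.d (σ (run σ I k)).1 := by
        by_contra hd
        exact hcl (Cleared.mono_run hk ((cleared_found (not_lt.1 hd) _).2 (Or.inl rfl)))
      have h3 : target σ (run σ I k) ≤ (run σ I n).reach (σ (run σ I k)).1 := by
        refine le_trans ?_ (reach_run_mono σ I _ hk)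
        simp only [run_succ]
        rw [reach_missed hm]
        exact le_max_left _ _
      have h4 : (target σ (run σ I k) : ℝ≥0∞) < J.d (σ (run σ I k)).1 :=
        lt_of_le_of_lt (ENNReal.coe_le_coe.2 h3) h2
      rw [nextStep_missed hm, nextStep_missed h4]

/-! ### Decoys: the adversary against offline strategies -/

/-- Hall's condition for pairing the values of `y` with strictly larger values of `e`. -/
theorem exists_perm_lt {α β : Type*} [Fintype α] [LinearOrder β] (y e : α → β)
    (H : ∀ a, (Finset.univ.filter fun b => y a ≤ y b).card
      ≤ (Finset.univ.filter fun b => y a < e b).card) :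
    ∃ τ : Equiv.Perm α, ∀ a, y a < e (τ a) := by
  have hall := (Finset.all_card_le_biUnion_card_iff_exists_injective
    (fun a => Finset.univ.filter fun b => y a < e b)).1 fun s => by
      rcases s.eq_empty_or_nonempty with rfl | hs
      · simp
      -- The neighbourhoods are nested, so that of the minimal `a` already contains all those of
      -- `s`.
      obtain ⟨a, ha, hmin⟩ := s.exists_min_image y hs
      calc s.card ≤ _ := Finset.card_le_card fun b hb => by simpa using hmin b hb
        _ ≤ _ := H a
        _ ≤ _ := Finset.card_le_card (Finset.subset_biUnion_of_mem
              (fun a => Finset.univ.filter fun b => y a < e b) ha)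
  obtain ⟨f, hf, hlt⟩ := hall
  refine ⟨Equiv.ofBijective f (Finite.injective_iff_bijective.1 hf), fun a => ?_⟩
  simpa using hlt a

/-- The set `F` of targets is worth too little, and a searcher who finds only targets from `F`
cannot rule out, with effort `B`, that all other targets lie beyond what was explored. -/
structure Decoy (I : Instance m) (F : Finset (Fin m)) (B : ℝ≥0) : Prop where
  light : ∑ i ∈ F, I.w i < I.W
  hidden : ∀ t : ℝ≥0, t ≤ B →
    (∀ i ∉ F, (t : ℝ≥0∞) < I.d i) ∨
    (B ≤ t * (Finset.univ.filter fun i => i ∉ F ∧ (t : ℝ≥0∞) < I.d i).card) ∨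
    (3 * B ≤ ∑ i with i ∈ F ∧ I.d i ≤ ((2 * t : ℝ≥0) : ℝ≥0∞), (I.d i).toNNReal)

/-- This is the threshold form of Hall's condition. The `N` rays explored at least to `y a` use up
`y a * N ≤ B` of the budget, so it is enough that the `M` hidden targets beyond `y a` satisfy `B ≤ y
a * M`. -/
theorem Decoy.card_le {I : Instance m} {F : Finset (Fin m)} {B : ℝ≥0} (D : Decoy I F B)
    (π : Equiv.Perm (Fin m)) (C : Fin m → Prop) (y : Fin m → ℝ≥0)
    (hF : ∀ r, ¬ C r → π r ∈ F → ∀ r', ¬ C r' → (y r' : ℝ≥0∞) < I.d (π r))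
    (hC : ∀ r, C r → π r ∈ F)
    (hB : ∑ r, (if C r then (I.d (π r)).toNNReal else y r) ≤ B) (a : Fin m) (ha : ¬ C a) :
    (Finset.univ.filter fun b => ¬ C b ∧ y a ≤ y b).card
      ≤ (Finset.univ.filter fun b => ¬ C b ∧ (y a : ℝ≥0∞) < I.d (π b)).card := by
  set N := (Finset.univ.filter fun b => ¬ C b ∧ y a ≤ y b).card with hN
  set M := (Finset.univ.filter fun b => ¬ C b ∧ (y a : ℝ≥0∞) < I.d (π b)).card with hM
  have all : (∀ b, ¬ C b → (y a : ℝ≥0∞) < I.d (π b)) → N ≤ M := fun h =>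
    Finset.card_le_card fun b => by
      simp only [Finset.mem_filter, Finset.mem_univ, true_and]
      exact fun hb => ⟨hb.1, h b hb.1⟩
  have hNB : y a * N ≤ B := by
    refine le_trans ?_ hB
    calc y a * N = ∑ b with ¬ C b ∧ y a ≤ y b, y a := by simp [hN, mul_comm]
      _ ≤ ∑ b with ¬ C b ∧ y a ≤ y b, (if C b then (I.d (π b)).toNNReal else y b) := by
          refine Finset.sum_le_sum fun b hb => ?_
          simp only [Finset.mem_filter, Finset.mem_univ, true_and] at hb
          rw [if_neg hb.1]
          exact hb.2
      _ ≤ _ := Finset.sum_le_sum_of_subset (Finset.filter_subset _ _)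
  have yaB : y a ≤ B := by
    refine le_trans ?_ hB
    have := Finset.single_le_sum (f := fun r => if C r then (I.d (π r)).toNNReal else y r)
      (fun _ _ => zero_le) (Finset.mem_univ a)
    simpa [ha] using this
  have fin : B ≤ y a * M → N ≤ M := fun h => by
    rcases eq_or_ne (y a) 0 with h0 | h0
    · refine all fun b _ => ?_
      rw [h0]
      simpa using zero_lt_one.trans_le (I.one_le_d (π b))
    · have := hNB.trans h
      rw [mul_le_mul_iff_right₀ (pos_iff_ne_zero.2 h0)] at this
      exact_mod_cast this
  rcases D.hidden (y a) yaB with h | h | h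
  · refine all fun b hb => ?_
    by_cases hbF : π b ∈ F
    · exact hF b hb hbF a ha
    · exact h _ hbF
  · refine fin (h.trans ?_)
    gcongr
    refine Finset.card_le_card_of_injOn (fun i => π.symm i) ?_ π.symm.injective.injOn
    intro i hi
    simp only [Finset.coe_filter, Finset.mem_univ, true_and, Set.mem_ofPred_eq] at hi ⊢
    refine ⟨fun hc => hi.1 ?_, by simpa using hi.2⟩
    simpa using hC _ hc
  -- Of the mass `3 * B` of `F` within `2 * y a`, found targets and futile exploration account for
  -- at most `B`. Each remaining target lies beyond `y a` by `hF` and contributes at most `2 * y a`;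
  -- hence `2 * B ≤ 2 * y a * M`.
  · refine fin ?_
    have h1 : ∑ i with i ∈ F ∧ I.d i ≤ ((2 * y a : ℝ≥0) : ℝ≥0∞), (I.d i).toNNReal
        = ∑ b, (if π b ∈ F ∧ I.d (π b) ≤ ((2 * y a : ℝ≥0) : ℝ≥0∞)
            then (I.d (π b)).toNNReal else 0) := by
      rw [Finset.sum_filter]
      exact (Equiv.sum_comp π (fun i => if i ∈ F ∧ I.d i ≤ ((2 * y a : ℝ≥0) : ℝ≥0∞)
            then (I.d i).toNNReal else 0)).symm
    have h2 : ∑ b, (if π b ∈ F ∧ I.d (π b) ≤ ((2 * y a : ℝ≥0) : ℝ≥0∞)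
            then (I.d (π b)).toNNReal else 0)
        ≤ ∑ b, ((if C b then (I.d (π b)).toNNReal else y b) +
            (if ¬ C b ∧ (y a : ℝ≥0∞) < I.d (π b) then 2 * y a else 0)) := by
      refine Finset.sum_le_sum fun b _ => ?_
      by_cases c1 : π b ∈ F ∧ I.d (π b) ≤ ((2 * y a : ℝ≥0) : ℝ≥0∞)
      · rw [if_pos c1]
        by_cases c2 : C b
        · rw [if_pos c2]
          exact le_self_add
        · rw [if_neg c2, if_pos ⟨c2, hF b c2 c1.1 a ha⟩]
          refine le_trans ?_ le_add_self
          simpa only [ENNReal.toNNReal_coe] using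
            ENNReal.toNNReal_mono ENNReal.coe_ne_top c1.2
      · rw [if_neg c1]
        exact zero_le
    rw [Finset.sum_add_distrib, ← Finset.sum_filter (fun b => ¬ C b ∧ (y a : ℝ≥0∞) < I.d (π b)),
      Finset.sum_const, ← hM, nsmul_eq_mul] at h2
    rw [h1] at h
    have h3 := h.trans h2
    rw [← NNReal.coe_le_coe] at h3 hB ⊢
    push_cast at h3 hB ⊢
    linarith

/-- The rays on which nothing was found can be given other targets, which lie beyond `y`. -/
theorem Decoy.exists_rematch {I : Instance m} {F : Finset (Fin m)} {B : ℝ≥0} (D : Decoy I F B)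
    (π : Equiv.Perm (Fin m)) (C : Fin m → Prop) (y : Fin m → ℝ≥0)
    (hF : ∀ r, ¬ C r → π r ∈ F → ∀ r', ¬ C r' → (y r' : ℝ≥0∞) < I.d (π r))
    (hC : ∀ r, C r → π r ∈ F)
    (hB : ∑ r, (if C r then (I.d (π r)).toNNReal else y r) ≤ B) :
    ∃ π' : Equiv.Perm (Fin m), (∀ r, C r → π' r = π r) ∧
      (∀ r, ¬ C r → (y r : ℝ≥0∞) < I.d (π' r)) ∧
      (∀ r, ¬ C r → π' r ∈ F → ∀ r', ¬ C r' → (y r' : ℝ≥0∞) < I.d (π' r)) := by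
  have key := D.card_le π C y hF hC hB
  have count : ∀ (P : Fin m → Prop) [DecidablePred P],
      (Finset.univ.filter fun b : {r // ¬ C r} => P b).card
        = (Finset.univ.filter fun b => ¬ C b ∧ P b).card := fun P _ => by
    rw [← Finset.card_map (Function.Embedding.subtype _)]
    congr 1
    ext b
    simp [and_comm]
  obtain ⟨τ, hτ⟩ := exists_perm_lt (α := {r // ¬ C r}) (fun r => (y r : ℝ≥0∞))
    (fun r => I.d (π r)) fun a => by
      have := key a a.2
      rw [← count (fun b => y a ≤ y b), ← count (fun b => (y a : ℝ≥0∞) < I.d (π b))] at this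
      simpa using this
  have e1 : ∀ r, C r → Equiv.Perm.ofSubtype τ r = r := fun r hr =>
    Equiv.Perm.ofSubtype_apply_of_not_mem τ (not_not.2 hr)
  have e2 : ∀ r (hr : ¬ C r), Equiv.Perm.ofSubtype τ r = τ ⟨r, hr⟩ := fun r hr =>
    Equiv.Perm.ofSubtype_apply_of_mem τ hr
  refine ⟨(Equiv.Perm.ofSubtype τ).trans π, fun r hr => ?_, fun r hr => ?_,
    fun r hr hrF r' hr' => ?_⟩
  · rw [Equiv.trans_apply, e1 r hr]
  · rw [Equiv.trans_apply, e2 r hr]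
    exact hτ ⟨r, hr⟩
  · rw [Equiv.trans_apply, e2 r hr] at hrF ⊢
    exact hF _ (τ ⟨r, hr⟩).2 hrF r' hr'

/-- Only targets from `F` were found, and those that were not found lie beyond all that was explored
in vain. -/
structure Evades (I : Instance m) (F : Finset (Fin m)) (π : Equiv.Perm (Fin m))
    (h : History m) : Prop where
  cleared : ∀ r, h.Cleared r → π r ∈ F
  ahead : ∀ r, ¬ h.Cleared r → π r ∈ F → ∀ r', ¬ h.Cleared r' →
    (h.reach r' : ℝ≥0∞) < I.d (π r)

theorem run_present_congr {σ : Strategy m} {I : Instance m} {π π' : Equiv.Perm (Fin m)} {n : ℕ}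
    (hc : ∀ r, History.Cleared (run σ (I.present π) n) r → π' r = π r)
    (hu : ∀ r, ¬ History.Cleared (run σ (I.present π) n) r →
      ((run σ (I.present π) n).reach r : ℝ≥0∞) < I.d (π' r)) :
    ∀ k ≤ n, run σ (I.present π') k = run σ (I.present π) k :=
  run_congr (fun r hr => by simp [Instance.present, hc r hr]) hu

/-- The adversary answers one excursion: it surrenders an unfound target of `F` if one lies within
the depth, and otherwise moves the hidden targets so that the ray is empty to that depth. -/
theorem Decoy.evade_step {I : Instance m} {F : Finset (Fin m)} {B : ℝ≥0} (D : Decoy I F B)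
    (σ : Strategy m) (n : ℕ) (π : Equiv.Perm (Fin m))
    (hT : (run σ (I.present π) n).effort ≤ B) (E : Evades I F π (run σ (I.present π) n)) :
    ∃ π' : Equiv.Perm (Fin m),
      (∀ k ≤ n, run σ (I.present π') k = run σ (I.present π) k) ∧
      ((run σ (I.present π') (n + 1)).effort ≤ B →
        Evades I F π' (run σ (I.present π') (n + 1))) := by
  set h := run σ (I.present π) n with hh
  have Fa : Faithful (I.present π) h := faithful_run σ _ n
  obtain ⟨r, hr⟩ : ∃ r, (σ h).1 = r := ⟨_, rfl⟩
  by_cases hcl : h.Cleared r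
  · refine ⟨π, fun _ _ => rfl, fun _ => ?_⟩
    have hm : (target σ h : ℝ≥0∞) < (I.present π).d (σ h).1 := by
      by_contra hd
      exact not_cleared_of_found (not_lt.1 hd) (hr ▸ hcl)
    rw [run_succ, ← hh]
    refine ⟨fun r' hr' => E.cleared _ ((cleared_missed hm _).1 hr'), fun r1 h1 h1F r2 h2 => ?_⟩
    rw [cleared_missed hm] at h1 h2
    rw [reach_nextStep_of_ne fun e => h2 (by rwa [e, hr])]
    exact E.ahead r1 h1 h1F r2 h2
  -- The depth is cut at the remaining budget, so that the hypothesis `hB` of the rematching holds;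
  -- nothing is claimed about a step that exceeds the budget.
  set l := min (target σ h) (B - h.effort) with hl
  have hlB : h.effort + l ≤ B := by
    calc h.effort + l ≤ h.effort + (B - h.effort) := by gcongr; exact min_le_right _ _
      _ = B := add_tsub_cancel_of_le hT
  have dcl : ∀ a, h.Cleared a → (I.d (π a)).toNNReal = h.reach a := fun a ha => by
    have := Fa.cleared a ha
    change _ = I.d (π a) at this
    rw [← this, ENNReal.toNNReal_coe]
  have total : ∑ a, (h.reach a + if a = r then l else 0) ≤ B := by
    refine le_trans ?_ hlB
    rw [Finset.sum_add_distrib]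
    simp only [Finset.sum_ite_eq', Finset.mem_univ, if_true]
    gcongr
    exact sum_reach_le_effort h
  by_cases hA : ∃ r1, ¬ h.Cleared r1 ∧ π r1 ∈ F ∧ I.d (π r1) ≤ l
  · obtain ⟨r1, h1, h1F, h1l⟩ := hA
    -- The target to be surrendered is brought to ray `r`; `ahead` guarantees that it lies beyond
    -- what was explored there.
    set ψ : Equiv.Perm (Fin m) := (Equiv.swap r r1).trans π with hψ
    have ψr : ψ r = π r1 := by simp [hψ]
    have ψc : ∀ a, h.Cleared a → ψ a = π a := fun a ha => by
      simp only [hψ, Equiv.trans_apply]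
      rw [Equiv.swap_apply_of_ne_of_ne (fun e : a = r => hcl (e ▸ ha))
        (fun e : a = r1 => h1 (e ▸ ha))]
    have ψu : ∀ a, ¬ h.Cleared a → ∃ b, ¬ h.Cleared b ∧ ψ a = π b := fun a ha => by
      refine ⟨Equiv.swap r r1 a, ?_, rfl⟩
      rw [Equiv.swap_apply_def]
      split_ifs <;> assumption
    obtain ⟨π', c1, c2, c3⟩ := D.exists_rematch ψ (fun a => a = r ∨ h.Cleared a) h.reach
      (fun a ha haF b hb => by
        obtain ⟨a', ha', e⟩ := ψu a fun hc => ha (Or.inr hc)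
        rw [e] at haF ⊢
        exact E.ahead a' ha' haF b fun hc => hb (Or.inr hc))
      (fun a ha => by
        rcases ha with rfl | ha
        · rwa [ψr]
        · rw [ψc a ha]
          exact E.cleared a ha)
      (by
        refine le_trans (Finset.sum_le_sum fun a _ => ?_) total
        by_cases e : a = r
        · subst e
          rw [if_pos (Or.inl rfl), if_pos rfl, ψr]
          refine le_trans ?_ le_add_self
          simpa only [ENNReal.toNNReal_coe] using ENNReal.toNNReal_mono ENNReal.coe_ne_top h1l
        · by_cases e' : h.Cleared a
          · rw [if_pos (Or.inr e'), ψc a e', dcl a e']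
            exact le_self_add
          · rw [if_neg (by tauto)]
            exact le_self_add)
    have c1r : π' r = π r1 := by rw [c1 r (Or.inl rfl), ψr]
    have same := run_present_congr (σ := σ) (I := I) (π := π) (π' := π') (n := n)
      (fun a ha => by rw [c1 a (Or.inr ha), ψc a ha])
      (fun a ha => by
        by_cases e : a = r
        · rw [e, c1r]
          exact E.ahead r1 h1 h1F _ hcl
        · exact c2 a (by tauto))
    refine ⟨π', same, fun _ => ?_⟩
    rw [run_succ, same n le_rfl, ← hh]
    have hd : (I.present π').d (σ h).1 ≤ target σ h := by
      change I.d (π' (σ h).1) ≤ _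
      rw [hr, c1r]
      exact h1l.trans (ENNReal.coe_le_coe.2 (min_le_left _ _))
    refine ⟨fun a ha => ?_, fun a ha haF b hb => ?_⟩
    · rcases (cleared_found hd a).1 ha with ha | ha
      · rw [ha, hr, c1r]; exact h1F
      · rw [c1 a (Or.inr ha), ψc a ha]; exact E.cleared a ha
    · rw [cleared_found hd, hr] at ha hb
      rw [reach_nextStep_of_ne (by rw [hr]; tauto)]
      exact c3 a ha haF b hb
  · push Not at hA
    -- These are the explored depths as if the excursion had already been made in vain.
    set y : Fin m → ℝ≥0 := fun a => if a = r then max l (h.reach a) else h.reach a with hy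
    have hy' : ∀ a, h.reach a ≤ y a := fun a => by
      simp only [hy]
      split_ifs
      · exact le_max_right _ _
      · exact le_rfl
    obtain ⟨π', c1, c2, c3⟩ := D.exists_rematch π (fun a => h.Cleared a) y
      (fun a ha haF b hb => by
        simp only [hy]
        split_ifs
        · rw [ENNReal.coe_max]
          exact max_lt (hA a ha haF) (E.ahead a ha haF b hb)
        · exact E.ahead a ha haF b hb)
      E.cleared
      (by
        refine le_trans (Finset.sum_le_sum fun a _ => ?_) total
        simp only [hy]
        split_ifs with e e' e'
        · rw [dcl a e]; exact le_self_add
        · rw [dcl a e]; exact le_self_add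
        · exact max_le le_add_self le_self_add
        · exact le_self_add)
    have same := run_present_congr (σ := σ) (I := I) (π := π) (π' := π') (n := n)
      (fun a ha => c1 a ha)
      (fun a ha => lt_of_le_of_lt (ENNReal.coe_le_coe.2 (hy' a)) (c2 a ha))
    refine ⟨π', same, fun hE => ?_⟩
    rw [run_succ, same n le_rfl, ← hh] at hE ⊢
    have hlr : (l : ℝ≥0∞) < I.d (π' r) := by
      refine lt_of_le_of_lt (ENNReal.coe_le_coe.2 ?_) (c2 r hcl)
      simp [hy]
    have hout : (nextStep σ (I.present π') h).out ≤ l := by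
      rw [effort_cons] at hE
      refine le_min (out_nextStep_le _ _ _) ?_
      exact le_tsub_of_add_le_right hE
    have hm : (target σ h : ℝ≥0∞) < (I.present π').d (σ h).1 := by
      by_contra hd
      rw [nextStep_found (not_lt.1 hd)] at hout
      have : I.d (π' r) ≤ l := by
        rw [← ENNReal.coe_le_coe] at hout
        refine le_trans (le_of_eq ?_) hout
        rw [← hr]
        exact (ENNReal.coe_toNNReal (ne_top_of_le_ne_top ENNReal.coe_ne_top (not_lt.1 hd))).symm
      exact absurd hlr this.not_gt
    have htl : target σ h ≤ l := by
      rw [nextStep_missed hm] at hout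
      exact hout
    refine ⟨fun a ha => ?_, fun a ha haF b hb => ?_⟩
    · rw [cleared_missed hm] at ha
      rw [c1 a ha]
      exact E.cleared a ha
    · rw [cleared_missed hm] at ha hb
      refine lt_of_le_of_lt (ENNReal.coe_le_coe.2 ?_) (c3 a ha haF b hb)
      by_cases e : b = r
      · rw [e, ← hr, reach_missed hm, hr]
        simp only [hy, if_true]
        exact max_le_max_right _ htl
      · rw [reach_nextStep_of_ne (by rwa [hr])]
        exact hy' b

theorem Decoy.gathered_lt {I : Instance m} {F : Finset (Fin m)} {B : ℝ≥0} (D : Decoy I F B)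
    {σ : Strategy m} {n : ℕ} {π : Equiv.Perm (Fin m)}
    (E : Evades I F π (run σ (I.present π) n)) :
    History.gathered (run σ (I.present π) n) < I.W := by
  rw [(faithful_run σ _ n).gathered]
  refine lt_of_le_of_lt ?_ D.light
  change ∑ r with History.Cleared (run σ (I.present π) n) r, I.w (π.toEmbedding r) ≤ _
  rw [← Finset.sum_map _ π.toEmbedding (fun i => I.w i)]
  refine Finset.sum_le_sum_of_subset fun i hi => ?_
  simp only [Finset.mem_map, Finset.mem_filter, Finset.mem_univ, true_and] at hi
  obtain ⟨r, hr, rfl⟩ := hi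
  exact E.cleared r hr

/-- Each change of permutation preserves the run so far, so one fixed permutation fools the searcher
for all `n` excursions. -/
theorem Decoy.exists_evading {I : Instance m} {F : Finset (Fin m)} {B : ℝ≥0} (D : Decoy I F B)
    (σ : Strategy m) (n : ℕ) : ∃ π : Equiv.Perm (Fin m),
      (∀ k ≤ n, (run σ (I.present π) k).effort ≤ B →
        History.gathered (run σ (I.present π) k) < I.W) ∧
      ((run σ (I.present π) n).effort ≤ B → Evades I F π (run σ (I.present π) n)) := by
  induction n with
  | zero =>
    have E : Evades I F 1 (run σ (I.present 1) 0) := by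
      refine ⟨fun r hr => absurd hr (not_cleared_nil r), fun r _ _ r' _ => ?_⟩
      simpa [run, History.reach] using zero_lt_one.trans_le (I.one_le_d r)
    refine ⟨1, fun k hk _ => ?_, fun _ => E⟩
    rw [Nat.le_zero.1 hk]
    exact D.gathered_lt E
  | succ n ih =>
    obtain ⟨π, h1, h2⟩ := ih
    by_cases hT : (run σ (I.present π) n).effort ≤ B
    · obtain ⟨π', same, hE⟩ := D.evade_step σ n π hT (h2 hT)
      refine ⟨π', fun k hk hkB => ?_, hE⟩
      rcases Nat.le_succ_iff.1 hk with hk | rfl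
      · rw [same k hk] at hkB ⊢
        exact h1 k hk hkB
      · exact D.gathered_lt (hE hkB)
    · have hT' : ¬ (run σ (I.present π) (n + 1)).effort ≤ B := fun h =>
        hT ((effort_run_mono σ _ n.le_succ).trans h)
      refine ⟨π, fun k hk hkB => ?_, fun h => absurd h hT'⟩
      rcases Nat.le_succ_iff.1 hk with hk | rfl
      · exact h1 k hk hkB
      · exact absurd hkB hT'

/-- A decoy forces every offline strategy to pay at least `B`. -/
theorem Decoy.le_intrinsicCost {I : Instance m} {F : Finset (Fin m)} {B : ℝ≥0}
    (D : Decoy I F B) : (B : ℝ≥0∞) ≤ intrinsicCost I := by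
  refine le_iInf fun σ => ?_
  by_contra! hlt
  have H : ∀ π : Equiv.Perm (Fin m), ∃ n, I.W ≤ History.gathered (run σ (I.present π) n) ∧
      (run σ (I.present π) n).effort ≤ B := fun π => by
    have := (le_iSup (fun π => cost σ (I.present π)) π).trans_lt hlt
    simp only [cost, iInf_lt_iff] at this
    obtain ⟨n, hn, hB⟩ := this
    exact ⟨n, hn, (effort_le_elapsed _).trans (ENNReal.coe_le_coe.1 hB.le)⟩
  choose N hN hNB using H
  -- There are finitely many presentations, so one number of excursions covers them all before `π`
  -- is chosen.
  obtain ⟨π, hπ, -⟩ := D.exists_evading σ (Finset.univ.sup N)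
  exact absurd (hN π) (hπ _ (Finset.le_sup (Finset.mem_univ π)) (hNB π)).not_ge

/-! ### Hyperbolic dovetailing and its effort -/

/-- With budget `2 ^ k`, ray `r` still has to be explored up to `2 ^ i`. -/
def Deficient (h : History m) (k i : ℕ) (r : Fin m) : Prop :=
  ¬ h.Cleared r ∧ h.reach r < 2 ^ i ∧ i ≤ k ∧
    2 ^ i * ((Finset.univ.filter fun a => ¬ h.Cleared a ∧ 2 ^ i ≤ h.reach a).card : ℝ≥0) < 2 ^ k ∧
    ∑ a with h.Cleared a ∧ h.reach a ≤ 2 ^ i, h.reach a < 2 ^ k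

/-- Hyperbolic dovetailing: a step that is due for the smallest budget possible. -/
def dovetail [NeZero m] : Strategy m := fun h =>
  if H : ∃ k i r, Deficient h k i r then
    ((Nat.find_spec H).choose_spec.choose, 2 ^ (Nat.find_spec H).choose)
  -- This case occurs only once every ray is cleared: an uncleared ray is deficient for some large
  -- budget.
  else (0, 0)

theorem dovetail_spec [NeZero m] {h : History m} {K : ℕ}
    (H : ∃ k ≤ K, ∃ i r, Deficient h k i r) :
    ∃ k ≤ K, ∃ i r, Deficient h k i r ∧ dovetail h = (r, 2 ^ i) := by
  obtain ⟨k, hk, i, r, hd⟩ := H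
  have H' : ∃ k i r, Deficient h k i r := ⟨k, i, r, hd⟩
  refine ⟨Nat.find H', (Nat.find_min' H' ⟨i, r, hd⟩).trans hk, (Nat.find_spec H').choose,
    (Nat.find_spec H').choose_spec.choose, (Nat.find_spec H').choose_spec.choose_spec, ?_⟩
  rw [dovetail, dif_pos H']

/-- What holds as long as all steps are due for budgets up to `2 ^ K`. -/
structure Tame (K : ℕ) (h : History m) : Prop where
  idle : ∀ r, ¬ h.Cleared r → h.reach r = 0 ∨ ∃ i ≤ K, h.reach r = 2 ^ i
  hit : ∀ r, h.Cleared r → 1 ≤ h.reach r ∧ h.reach r ≤ 2 ^ K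
  idle_class : ∀ i : ℕ, ∑ r with ¬ h.Cleared r ∧ h.reach r = 2 ^ i, h.reach r ≤ 2 * 2 ^ K
  hit_class : ∀ i : ℕ, ∑ r with h.Cleared r ∧ 2 ^ i < 2 * h.reach r ∧ h.reach r ≤ 2 ^ i,
    h.reach r ≤ 2 * 2 ^ K
  effort_le : h.effort ≤ ∑ r, if h.Cleared r then 3 * h.reach r else 2 * h.reach r
  length_le : (h.length : ℝ≥0) ≤ h.effort

theorem tame_nil (K : ℕ) : Tame K ([] : History m) := by
  refine ⟨fun r _ => Or.inl rfl, fun r hr => absurd hr (not_cleared_nil r), fun i => ?_, fun i => ?_,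
    by simp, by simp⟩ <;> simp [History.reach]

theorem two_pow_lt_iff {i j : ℕ} : (2 : ℝ≥0) ^ i < 2 ^ j ↔ i < j :=
  pow_lt_pow_iff_right₀ one_lt_two

theorem two_pow_le_iff {i j : ℕ} : (2 : ℝ≥0) ^ i ≤ 2 ^ j ↔ i ≤ j :=
  pow_le_pow_iff_right₀ one_lt_two

theorem sum_add_single (f : Fin m → ℝ≥0) (r : Fin m) (x : ℝ≥0) :
    ∑ a, (f a + if a = r then x else 0) = ∑ a, f a + x := by
  rw [Finset.sum_add_distrib]
  simp

/-- Deficiency bounds the mass of idle class `i` by `2 ^ K` before the step, which adds at most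
another `2 ^ K`. The depths on an idle ray at least double, so its effort is at most twice its
reach. -/
theorem Tame.missed {K k i : ℕ} {h : History m} {I : Instance m} {σ : Strategy m} {r : Fin m}
    (T : Tame K h) (D : Deficient h k i r) (hk : k ≤ K) (hσ : σ h = (r, 2 ^ i))
    (hd : (target σ h : ℝ≥0∞) < I.d (σ h).1) : Tame K (nextStep σ I h :: h) := by
  obtain ⟨hcl, hlt, hik, hcard, -⟩ := D
  have ht : target σ h = 2 ^ i := by simp [target, hσ, hcl]
  have hout : (nextStep σ I h).out = 2 ^ i := by rw [nextStep_missed hd, ← ht]; rfl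
  have hcl' := cleared_missed hd
  have hne : ∀ a, a ≠ r → History.reach (nextStep σ I h :: h) a = h.reach a := fun a ha =>
    reach_nextStep_of_ne (by rwa [hσ])
  have heq : History.reach (nextStep σ I h :: h) r = 2 ^ i := by
    have := reach_missed hd
    rw [hσ] at this
    rw [this, ht]
    exact max_eq_left hlt.le
  have hiK : (2 : ℝ≥0) ^ i ≤ 2 ^ K := two_pow_le_iff.2 (hik.trans hk)
  refine ⟨fun a ha => ?_, fun a ha => ?_, fun j => ?_, fun j => ?_, ?_, ?_⟩
  · rw [hcl'] at ha
    by_cases e : a = r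
    · rw [e, heq]
      exact Or.inr ⟨i, hik.trans hk, rfl⟩
    · rw [hne a e]
      exact T.idle a ha
  · rw [hcl'] at ha
    rw [hne a fun e => hcl (e ▸ ha)]
    exact T.hit a ha
  · by_cases hji : j = i
    · subst hji
      calc _ ≤ ∑ a, ((if ¬ h.Cleared a ∧ h.reach a = 2 ^ j then h.reach a else 0)
            + if a = r then 2 ^ j else 0) := by
            rw [Finset.sum_filter]
            refine Finset.sum_le_sum fun a _ => ?_
            rw [hcl']
            by_cases e : a = r
            · rw [e, heq, if_pos rfl, if_pos ⟨hcl, rfl⟩]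
              exact le_add_self
            · rw [hne a e]
              exact le_self_add
        _ = ∑ a with ¬ h.Cleared a ∧ h.reach a = 2 ^ j, h.reach a + 2 ^ j := by
            rw [sum_add_single, Finset.sum_filter]
        _ ≤ 2 ^ K + 2 ^ K := by
            gcongr
            refine le_trans ?_ (hcard.le.trans (two_pow_le_iff.2 hk))
            rw [mul_comm, ← nsmul_eq_mul, ← Finset.sum_const]
            calc _ = ∑ a with ¬ h.Cleared a ∧ h.reach a = 2 ^ j, (2 : ℝ≥0) ^ j :=
                  Finset.sum_congr rfl fun a ha => (Finset.mem_filter.1 ha).2.2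
              _ ≤ _ := Finset.sum_le_sum_of_subset fun a ha => by
                  simp only [Finset.mem_filter, Finset.mem_univ, true_and] at ha ⊢
                  exact ⟨ha.1, ha.2.ge⟩
        _ = _ := (two_mul _).symm
    · refine le_trans ?_ (T.idle_class j)
      rw [Finset.sum_filter, Finset.sum_filter]
      refine Finset.sum_le_sum fun a _ => ?_
      rw [hcl']
      by_cases e : a = r
      · rw [e, heq, if_neg]
        · exact zero_le
        · rintro ⟨-, h2⟩
          exact hji (le_antisymm (two_pow_le_iff.1 h2.ge) (two_pow_le_iff.1 h2.le))
      · rw [hne a e]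
  · refine le_trans ?_ (T.hit_class j)
    rw [Finset.sum_filter, Finset.sum_filter]
    refine Finset.sum_le_sum fun a _ => ?_
    rw [hcl']
    by_cases e : a = r
    · rw [e, if_neg (by tauto)]
      exact zero_le
    · rw [hne a e]
  · rw [effort_cons, hout, add_comm]
    refine (add_le_add_left T.effort_le _).trans ?_
    rw [← sum_add_single _ r]
    refine Finset.sum_le_sum fun a _ => ?_
    rw [hcl']
    by_cases e : a = r
    · rw [e, if_neg hcl, if_neg hcl, if_pos rfl, heq, two_mul (2 ^ i)]
      gcongr
      rcases T.idle r hcl with h0 | ⟨j, -, hj⟩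
      · rw [h0, mul_zero]; exact zero_le
      · rw [hj] at hlt ⊢
        rw [mul_comm, ← pow_succ]
        exact two_pow_le_iff.2 (two_pow_lt_iff.1 hlt)
    · rw [hne a e, if_neg e, add_zero]
  · rw [effort_cons, hout, List.length_cons, Nat.cast_add_one, add_comm]
    exact add_le_add (one_le_pow₀ one_le_two) T.length_le

/-- The dyadic shell of the new target is within depth `2 ^ i`, where the found distances still
summed to less than `2 ^ k`. The final excursion raises the factor of the ray from 2 to 3. -/
theorem Tame.found {K k i : ℕ} {h : History m} {I : Instance m} {σ : Strategy m} {r : Fin m}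
    (T : Tame K h) (F : Faithful I h) (D : Deficient h k i r) (hk : k ≤ K)
    (hσ : σ h = (r, 2 ^ i)) (hd : I.d (σ h).1 ≤ target σ h) :
    Tame K (nextStep σ I h :: h) := by
  obtain ⟨hcl, hlt, hik, -, hsum⟩ := D
  have ht : target σ h = 2 ^ i := by simp [target, hσ, hcl]
  have hcl' := cleared_found hd
  have heq := F.reach_found hd
  have hreach : History.reach (nextStep σ I h :: h) r = (nextStep σ I h).out := by
    rw [hσ] at heq
    rw [heq, nextStep_found hd]
    simp [Step.out, hσ]
  have hne : ∀ a, a ≠ r → History.reach (nextStep σ I h :: h) a = h.reach a := fun a ha =>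
    reach_nextStep_of_ne (by rwa [hσ])
  have hone : 1 ≤ (nextStep σ I h).out := by
    rw [nextStep_found hd]
    have := ENNReal.toNNReal_mono (ne_top_of_le_ne_top ENNReal.coe_ne_top hd)
      (I.one_le_d (σ h).1)
    simpa [Step.out] using this
  have hle : (nextStep σ I h).out ≤ 2 ^ i := ht ▸ out_nextStep_le σ I h
  have hge : h.reach r ≤ (nextStep σ I h).out := by
    rw [← hreach, History.reach]
    split_ifs
    · exact le_max_right _ _
    · exact le_rfl
  simp only [hσ] at hcl'
  obtain ⟨x, hx⟩ : ∃ x, (nextStep σ I h).out = x := ⟨_, rfl⟩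
  rw [hx] at hreach hone hle hge
  have hiK : (2 : ℝ≥0) ^ i ≤ 2 ^ K := two_pow_le_iff.2 (hik.trans hk)
  have idle' : ∀ a, ¬ History.Cleared (nextStep σ I h :: h) a → a ≠ r ∧ ¬ h.Cleared a :=
    fun a ha => by rwa [hcl', not_or] at ha
  refine ⟨fun a ha => ?_, fun a ha => ?_, fun j => ?_, fun j => ?_, ?_, ?_⟩
  · obtain ⟨e, ha⟩ := idle' a ha
    rw [hne a e]
    exact T.idle a ha
  · by_cases e : a = r
    · rw [e, hreach]
      exact ⟨hone, hle.trans hiK⟩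
    · rw [hne a e]
      exact T.hit a (((hcl' a).1 ha).resolve_left e)
  · refine le_trans ?_ (T.idle_class j)
    rw [Finset.sum_filter, Finset.sum_filter]
    refine Finset.sum_le_sum fun a _ => ?_
    by_cases e : a = r
    · rw [if_neg fun hc => (idle' a hc.1).1 e]
      exact zero_le
    · rw [hne a e, hcl']
      simp only [e, false_or, le_refl]
  · by_cases hc : 2 ^ j < 2 * x ∧ x ≤ 2 ^ j
    · have hji : j ≤ i := by
        have : (2 : ℝ≥0) ^ j < 2 ^ (i + 1) := by
          rw [pow_succ, mul_comm]
          exact hc.1.trans_le (by gcongr)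
        exact Nat.lt_succ_iff.1 (two_pow_lt_iff.1 this)
      calc _ ≤ ∑ a, ((if h.Cleared a ∧ 2 ^ j < 2 * h.reach a ∧ h.reach a ≤ 2 ^ j
              then h.reach a else 0) + if a = r then x else 0) := by
            rw [Finset.sum_filter]
            refine Finset.sum_le_sum fun a _ => ?_
            by_cases e : a = r
            · rw [e, hreach, if_pos rfl]
              refine le_trans ?_ le_add_self
              split_ifs
              · exact le_rfl
              · exact zero_le
            · rw [hne a e, hcl']
              simp only [e, false_or]
              exact le_self_add
        _ = ∑ a with h.Cleared a ∧ 2 ^ j < 2 * h.reach a ∧ h.reach a ≤ 2 ^ j, h.reach a + x := by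
            rw [sum_add_single, Finset.sum_filter]
        _ ≤ 2 ^ K + 2 ^ K := by
            refine add_le_add ?_ (hle.trans hiK)
            refine le_trans ?_ (hsum.le.trans (two_pow_le_iff.2 hk))
            refine Finset.sum_le_sum_of_subset fun a ha => ?_
            simp only [Finset.mem_filter, Finset.mem_univ, true_and] at ha ⊢
            exact ⟨ha.1, ha.2.2.trans (two_pow_le_iff.2 hji)⟩
        _ = _ := (two_mul _).symm
    · refine le_trans ?_ (T.hit_class j)
      rw [Finset.sum_filter, Finset.sum_filter]
      refine Finset.sum_le_sum fun a _ => ?_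
      by_cases e : a = r
      · rw [e, hreach, if_neg fun h => hc h.2]
        exact zero_le
      · rw [hne a e, hcl']
        simp only [e, false_or, le_refl]
  · rw [effort_cons, hx, add_comm]
    refine (add_le_add_left T.effort_le _).trans ?_
    rw [← sum_add_single _ r]
    refine Finset.sum_le_sum fun a _ => ?_
    by_cases e : a = r
    · rw [e, if_neg hcl, if_pos ((hcl' r).2 (Or.inl rfl)), if_pos rfl, hreach,
        show 3 * x = 2 * x + x by ring]
      gcongr
    · rw [hne a e, if_neg e, add_zero, hcl']
      simp only [e, false_or, le_refl]
  · rw [effort_cons, hx, List.length_cons, Nat.cast_add_one, add_comm]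
    exact add_le_add hone T.length_le

theorem Tame.next [NeZero m] {K : ℕ} {h : History m} {I : Instance m} (T : Tame K h)
    (F : Faithful I h) (D : ∃ k ≤ K, ∃ i r, Deficient h k i r) :
    Tame K (nextStep dovetail I h :: h) := by
  obtain ⟨k, hk, i, r, hD, hσ⟩ := dovetail_spec D
  rcases le_or_gt (I.d (dovetail h).1) (target dovetail h) with hd | hd
  · exact T.found F hD hk hσ hd
  · exact T.missed hD hk hσ hd

/-- The top `L` classes take `4 * 2 ^ K` each; those below form a geometric series with sum at most
`2 * 2 ^ K`. This is where the logarithm arises. -/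
theorem sum_min_two_pow_le (L K : ℕ) :
    ∑ i ∈ Finset.range (K + 1), min ((2 : ℝ≥0) ^ L * 2 ^ i) (4 * 2 ^ K)
      ≤ (4 * L + 2) * 2 ^ K := by
  have tail : ∀ M j : ℕ, ∑ i ∈ Finset.range (M + j), min ((2 : ℝ≥0) ^ L * 2 ^ i) (4 * 2 ^ K)
      ≤ 2 ^ L * 2 ^ M + 4 * j * 2 ^ K := fun M j => by
    induction j with
    | zero =>
      simp only [add_zero, Nat.cast_zero, mul_zero, zero_mul]
      calc _ ≤ ∑ i ∈ Finset.range M, (2 : ℝ≥0) ^ L * 2 ^ i :=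
            Finset.sum_le_sum fun i _ => min_le_left _ _
        _ ≤ _ := by
            rw [← Finset.mul_sum]
            gcongr
            have := Nat.geomSum_lt (m := 2) (n := M) (s := Finset.range M) le_rfl
              (fun k hk => Finset.mem_range.1 hk)
            exact_mod_cast this.le
    | succ j ih =>
      rw [← add_assoc, Finset.sum_range_succ]
      calc _ ≤ (2 ^ L * 2 ^ M + 4 * j * 2 ^ K) + 4 * (2 : ℝ≥0) ^ K :=
            add_le_add ih (min_le_right _ _)
        _ = _ := by push_cast; ring
  rcases le_or_gt L K with h | h
  · obtain ⟨M, rfl⟩ := Nat.exists_eq_add_of_le h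
    rw [show L + M + 1 = (M + 1) + L by ring]
    refine (tail (M + 1) L).trans (le_of_eq ?_)
    ring
  · calc _ ≤ ∑ i ∈ Finset.range (K + 1), 4 * (2 : ℝ≥0) ^ K :=
          Finset.sum_le_sum fun i _ => min_le_right _ _
      _ = 4 * (K + 1 : ℕ) * 2 ^ K := by simp; ring
      _ ≤ (4 * L + 2) * 2 ^ K := by
          gcongr
          refine le_trans ?_ le_self_add
          gcongr
          exact h

theorem Tame.effort_bound {K L : ℕ} {h : History m} (T : Tame K h) (hL : m ≤ 2 ^ L) :
    h.effort ≤ 3 * ((4 * L + 2) * 2 ^ K) := by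
  have class_of : ∀ r, h.reach r = 0 ∨
      ∃ i ≤ K, 2 ^ i < 2 * h.reach r ∧ h.reach r ≤ 2 ^ i := fun r => by
    by_cases hr : h.Cleared r
    · obtain ⟨h1, h2⟩ := T.hit r hr
      right
      have ex : ∃ i, h.reach r ≤ 2 ^ i := ⟨K, h2⟩
      refine ⟨Nat.find ex, Nat.find_min' ex h2, ?_, Nat.find_spec ex⟩
      rcases hn : Nat.find ex with _ | n
      · rw [pow_zero]
        calc (1 : ℝ≥0) < 2 * 1 := by norm_num
          _ ≤ _ := by gcongr
      · have := Nat.find_min ex (m := n) (by omega)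
        rw [pow_succ, mul_comm]
        gcongr
        exact not_le.1 this
    · refine (T.idle r hr).imp_right ?_
      rintro ⟨i, hi, e⟩
      refine ⟨i, hi, ?_, e.le⟩
      rw [e, two_mul]
      exact lt_add_of_pos_right _ (by positivity)
  have class_le : ∀ i : ℕ, ∑ r with 2 ^ i < 2 * h.reach r ∧ h.reach r ≤ 2 ^ i, h.reach r
      ≤ min (2 ^ L * 2 ^ i) (4 * 2 ^ K) := fun i => by
    refine le_min ?_ ?_
    · calc _ ≤ ∑ r with 2 ^ i < 2 * h.reach r ∧ h.reach r ≤ 2 ^ i, (2 : ℝ≥0) ^ i :=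
            Finset.sum_le_sum fun r hr => (Finset.mem_filter.1 hr).2.2
        _ ≤ ∑ r : Fin m, (2 : ℝ≥0) ^ i := Finset.sum_le_sum_of_subset (Finset.filter_subset _ _)
        _ = m * 2 ^ i := by simp
        _ ≤ _ := by
            gcongr
            exact_mod_cast hL
    · calc _ ≤ ∑ r with h.Cleared r ∧ 2 ^ i < 2 * h.reach r ∧ h.reach r ≤ 2 ^ i, h.reach r
            + ∑ r with ¬ h.Cleared r ∧ h.reach r = 2 ^ i, h.reach r := by
            rw [Finset.sum_filter, Finset.sum_filter, Finset.sum_filter,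
              ← Finset.sum_add_distrib]
            refine Finset.sum_le_sum fun r _ => ?_
            by_cases hc : 2 ^ i < 2 * h.reach r ∧ h.reach r ≤ 2 ^ i
            · rw [if_pos hc]
              by_cases hr : h.Cleared r
              · rw [if_pos ⟨hr, hc⟩]
                exact le_self_add
              · refine le_trans ?_ le_add_self
                rcases T.idle r hr with h0 | ⟨j, -, hj⟩
                · rw [h0]; exact zero_le
                · obtain ⟨c1, c2⟩ := hc
                  rw [hj, mul_comm, ← pow_succ, two_pow_lt_iff] at c1
                  rw [hj, two_pow_le_iff] at c2
                  have e : j = i := by omega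
                  rw [if_pos ⟨hr, e ▸ hj⟩]
            · rw [if_neg hc]
              exact zero_le
        _ ≤ 2 * 2 ^ K + 2 * 2 ^ K := add_le_add (T.hit_class i) (T.idle_class i)
        _ = _ := by ring
  calc h.effort ≤ _ := T.effort_le
    _ ≤ ∑ r, 3 * h.reach r := by
        refine Finset.sum_le_sum fun r _ => ?_
        split_ifs
        · exact le_rfl
        · gcongr
          norm_num
    _ = 3 * ∑ r, h.reach r := (Finset.mul_sum _ _ _).symm
    _ ≤ _ := by
        gcongr
        refine le_trans ?_ ((Finset.sum_le_sum fun i _ => class_le i).trans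
          (sum_min_two_pow_le L K))
        simp only [Finset.sum_filter]
        rw [Finset.sum_comm]
        refine Finset.sum_le_sum fun r _ => ?_
        rcases class_of r with h0 | ⟨i, hi, hc⟩
        · rw [h0]; exact zero_le
        · refine le_trans ?_ (Finset.single_le_sum (fun _ _ => zero_le)
            (Finset.mem_range.2 (Nat.lt_succ_of_le hi)))
          rw [if_pos hc]

theorem length_run (σ : Strategy m) (I : Instance m) (n : ℕ) : (run σ I n).length = n := by
  induction n with
  | zero => rfl
  | succ n ih => rw [run_succ, List.length_cons, ih]

/-- Were a step due for `2 ^ K` forever, all steps would serve budgets up to `2 ^ K` and the effort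
would stay bounded; but every such step costs at least 1. -/
theorem exists_not_deficient [NeZero m] {L : ℕ} (hL : m ≤ 2 ^ L) (I : Instance m) (K : ℕ) :
    ∃ n, (run dovetail I n).effort ≤ 3 * ((4 * L + 2) * 2 ^ K) ∧
      ∀ i r, ¬ Deficient (run dovetail I n) K i r := by
  by_contra! hcon
  have tame : ∀ n, Tame K (run dovetail I n) := fun n => by
    induction n with
    | zero => exact tame_nil K
    | succ n ih =>
      obtain ⟨i, r, hD⟩ := hcon n (ih.effort_bound hL)
      exact ih.next (faithful_run _ _ _) ⟨K, le_rfl, i, r, hD⟩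
  obtain ⟨n, hn⟩ := exists_nat_gt (3 * ((4 * L + 2) * 2 ^ K) : ℝ≥0)
  have := (tame n).length_le.trans ((tame n).effort_bound hL)
  rw [length_run] at this
  exact absurd hn this.not_gt

/-! ### Competitiveness of dovetailing -/

/-- If no step is due for the budget `2 ^ K`, the targets found are a decoy, unless they are worth
enough. -/
theorem decoy_of_not_deficient {I : Instance m} {h : History m} {K : ℕ} (F : Faithful I h)
    (hD : ∀ i r, ¬ Deficient h K i r) (hW : h.gathered < I.W) :
    Decoy I (Finset.univ.filter fun r => h.Cleared r) (2 ^ K / 4) := by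
  refine ⟨F.gathered ▸ hW, fun t ht => ?_⟩
  simp only [Finset.mem_filter, Finset.mem_univ, true_and]
  rcases lt_or_ge t 1 with h1 | h1
  · exact Or.inl fun r _ => lt_of_lt_of_le (by exact_mod_cast h1) (I.one_le_d r)
  -- Level `i + 1` is the right one: `t < 2 ^ (i + 1) ≤ 2 * t`. Each way in which deficiency can
  -- fail there gives one alternative of `hidden`.
  obtain ⟨i, hi, hi'⟩ := exists_nat_pow_near h1 one_lt_two
  have beyond : ∀ r, ¬ h.Cleared r → 2 ^ (i + 1) ≤ h.reach r → (t : ℝ≥0∞) < I.d r :=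
    fun r hr hr' => lt_trans (ENNReal.coe_lt_coe.2 (hi'.trans_le hr')) (F.uncleared r hr)
  have hiK : i + 1 ≤ K := by
    have h2 : (2 : ℝ≥0) ^ i < 2 ^ K :=
      (hi.trans ht).trans_lt (div_lt_self (by positivity) (by norm_num))
    exact two_pow_lt_iff.1 h2
  have h2t : (2 : ℝ≥0) ^ (i + 1) ≤ 2 * t := by
    rw [pow_succ, mul_comm]
    gcongr
  by_cases hall : ∀ r, ¬ h.Cleared r → 2 ^ (i + 1) ≤ h.reach r
  · exact Or.inl fun r hr => beyond r hr (hall r hr)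
  push Not at hall
  obtain ⟨r, hr, hr'⟩ := hall
  by_cases hcard : 2 ^ (i + 1) *
      ((Finset.univ.filter fun a => ¬ h.Cleared a ∧ 2 ^ (i + 1) ≤ h.reach a).card : ℝ≥0) < 2 ^ K
  · have hs := not_lt.1 fun hs => hD (i + 1) r ⟨hr, hr', hiK, hcard, hs⟩
    refine Or.inr (Or.inr ?_)
    -- The factor 3 in `hidden` is why the decoy is claimed for only a quarter of the budget.
    calc 3 * ((2 : ℝ≥0) ^ K / 4) ≤ 2 ^ K := by
          rw [← NNReal.coe_le_coe]
          push_cast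
          have : (0 : ℝ) < 2 ^ K := by positivity
          linarith
      _ ≤ _ := hs
      _ = ∑ a with h.Cleared a ∧ h.reach a ≤ 2 ^ (i + 1), (I.d a).toNNReal := by
          refine Finset.sum_congr rfl fun a ha => ?_
          rw [← F.cleared a (Finset.mem_filter.1 ha).2.1, ENNReal.toNNReal_coe]
      _ ≤ _ := by
          refine Finset.sum_le_sum_of_subset fun a ha => ?_
          simp only [Finset.mem_filter, Finset.mem_univ, true_and] at ha ⊢
          refine ⟨ha.1, ?_⟩
          rw [← F.cleared a ha.1]
          exact ENNReal.coe_le_coe.2 (ha.2.trans h2t)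
  · refine Or.inr (Or.inl ?_)
    have hle : (Finset.univ.filter fun a => ¬ h.Cleared a ∧ 2 ^ (i + 1) ≤ h.reach a).card
        ≤ (Finset.univ.filter fun a => ¬ h.Cleared a ∧ (t : ℝ≥0∞) < I.d a).card :=
      Finset.card_le_card fun a ha => by
        simp only [Finset.mem_filter, Finset.mem_univ, true_and] at ha ⊢
        exact ⟨ha.1, beyond a ha.1 ha.2⟩
    have h3 := (not_lt.1 hcard).trans (mul_le_mul h2t (Nat.cast_le.2 hle) zero_le zero_le)
    rw [← NNReal.coe_le_coe] at h3 ⊢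
    push_cast at h3 ⊢
    have : (0 : ℝ) < 2 ^ K := by positivity
    linarith

theorem cost_dovetail_le [NeZero m] {L : ℕ} (hL : m ≤ 2 ^ L) (I : Instance m) (K : ℕ)
    (hK : intrinsicCost I < ((2 ^ K / 4 : ℝ≥0) : ℝ≥0∞)) :
    cost dovetail I ≤ ((2 * (3 * ((4 * L + 2) * 2 ^ K)) : ℝ≥0) : ℝ≥0∞) := by
  obtain ⟨n, hn, hD⟩ := exists_not_deficient hL I K
  have hW : I.W ≤ (run dovetail I n).gathered := by
    by_contra! hW
    exact hK.not_ge (decoy_of_not_deficient (faithful_run _ _ _) hD hW).le_intrinsicCost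
  refine (iInf₂_le n hW).trans (ENNReal.coe_le_coe.2 ?_)
  refine (elapsed_le_two_mul_effort _).trans ?_
  gcongr

theorem cost_eq_zero_of_W_eq_zero {I : Instance m} (hW : I.W = 0) (σ : Strategy m) :
    cost σ I = 0 := by
  refine le_antisymm ((iInf₂_le 0 ?_).trans ?_) zero_le
  · rw [hW]; exact zero_le
  · simp [run, History.elapsed]

/-- The empty decoy works because no target is closer than 1. The bound lets a power of two be
chosen near the intrinsic cost. -/
theorem half_le_intrinsicCost {I : Instance m} (hW : I.W ≠ 0) :
    ((1 / 2 : ℝ≥0) : ℝ≥0∞) ≤ intrinsicCost I := by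
  refine Decoy.le_intrinsicCost (F := ∅) ⟨by simpa using pos_iff_ne_zero.2 hW, fun t ht => ?_⟩
  refine Or.inl fun i _ => lt_of_lt_of_le ?_ (I.one_le_d i)
  have : t < 1 := ht.trans_lt (by rw [← NNReal.coe_lt_coe]; norm_num)
  exact_mod_cast this

theorem cost_dovetail_le_mul [NeZero m] {L : ℕ} (hL : m ≤ 2 ^ L) (I : Instance m) :
    cost dovetail I ≤ ((48 * (4 * L + 2) : ℝ≥0) : ℝ≥0∞) * intrinsicCost I := by
  by_cases hW : I.W = 0
  · rw [cost_eq_zero_of_W_eq_zero hW]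
    exact zero_le
  by_cases htop : intrinsicCost I = ⊤
  · rw [htop, ENNReal.mul_top]
    · exact le_top
    · exact ENNReal.coe_ne_zero.2 (by positivity)
  obtain ⟨x, hx⟩ := (⟨_, ENNReal.coe_toNNReal htop⟩ :
    ∃ x : ℝ≥0, (x : ℝ≥0∞) = intrinsicCost I)
  have hhalf := half_le_intrinsicCost hW
  rw [← hx, ENNReal.coe_le_coe] at hhalf
  -- Budget `2 ^ (K + 1)` exceeds `4 * x`, as the decoy bound needs, but is at most `8 * x`; with
  -- the factor 6 of `cost_dovetail_le` this gives 48.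
  obtain ⟨K, hK1, hK2⟩ := exists_nat_pow_near (x := 4 * x) (y := 2)
    (by
      rw [← NNReal.coe_le_coe] at hhalf ⊢
      push_cast at hhalf ⊢
      linarith) one_lt_two
  refine (cost_dovetail_le hL I (K + 1) ?_).trans ?_
  · rw [← hx, ENNReal.coe_lt_coe, lt_div_iff₀ (by norm_num), mul_comm]
    exact hK2
  · rw [← hx, ← ENNReal.coe_mul, ENNReal.coe_le_coe]
    calc _ = 12 * (4 * (L : ℝ≥0) + 2) * 2 ^ K := by ring
      _ ≤ 12 * (4 * (L : ℝ≥0) + 2) * (4 * x) := by gcongr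
      _ = _ := by ring

/-! ### Lower bound for online algorithms -/

/-- No targets at all. -/
def blank (m : ℕ) : Instance m where
  W := 0
  d := fun _ => ∞
  w := fun _ => 0
  one_le_d := fun _ => le_top
  feasible := zero_le

/-- Any single target suffices. -/
def anyTarget [NeZero m] (d : Fin m → ℝ≥0) (hd : ∀ i, 1 ≤ d i) : Instance m where
  W := 1
  d := fun i => d i
  w := fun _ => 1
  one_le_d := fun i => by exact_mod_cast hd i
  feasible := by
    simp only [ne_eq, ENNReal.coe_ne_top, not_false_eq_true, Finset.filter_true,
      Finset.sum_const, Finset.card_univ, Fintype.card_fin, nsmul_eq_mul, mul_one]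
    exact_mod_cast NeZero.one_le

theorem not_cleared_blank (σ : Strategy m) (n : ℕ) (r : Fin m) :
    ¬ History.Cleared (run σ (blank m) n) r := fun h =>
  ENNReal.coe_ne_top ((faithful_run σ (blank m) n).cleared r h)

theorem gathered_blank (σ : Strategy m) (n : ℕ) : (run σ (blank m) n).gathered = 0 := by
  rw [(faithful_run σ _ n).gathered]
  simp [not_cleared_blank]

theorem run_anyTarget [NeZero m] {σ : Strategy m} {n : ℕ} {d : Fin m → ℝ≥0}
    (hd : ∀ i, 1 ≤ d i) (hlt : ∀ r, (run σ (blank m) n).reach r < d r) :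
    ∀ k ≤ n, run σ (anyTarget d hd) k = run σ (blank m) k :=
  run_congr (fun r hr => absurd hr (not_cleared_blank σ n r))
    fun r _ => ENNReal.coe_lt_coe.2 (hlt r)

theorem le_cost_anyTarget [NeZero m] {σ : Strategy m} {n : ℕ} {d : Fin m → ℝ≥0}
    (hd : ∀ i, 1 ≤ d i) (hlt : ∀ r, (run σ (blank m) n).reach r < d r) :
    ((run σ (blank m) n).effort : ℝ≥0∞) ≤ cost σ (anyTarget d hd) := by
  have same := run_anyTarget hd hlt
  refine le_iInf₂ fun k hk => ENNReal.coe_le_coe.2 ?_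
  rcases le_or_gt k n with h | h
  · rw [same k h, gathered_blank] at hk
    exact absurd hk (not_le.2 (zero_lt_one (α := ℝ≥0)))
  · refine le_trans ?_ (effort_le_elapsed _)
    rw [← same n le_rfl]
    exact effort_run_mono σ _ h.le

theorem effort_run_le {σ : Strategy m} {I : Instance m} {D : ℝ≥0} (h : ∀ h, (σ h).2 ≤ D)
    (n : ℕ) : (run σ I n).effort ≤ n * D := by
  induction n with
  | zero => simp [run]
  | succ n ih =>
    rw [run_succ, effort_cons, Nat.cast_add_one, add_mul, one_mul, add_comm]
    refine add_le_add ih ((out_nextStep_le _ _ _).trans ?_)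
    rw [target]
    split_ifs
    · exact zero_le
    · exact h _

/-- Sweeping `j + 1` rays up to a depth beyond which there are at most `j` targets. -/
theorem intrinsicCost_anyTarget_le [NeZero m] {d : Fin m → ℝ≥0} (hd : ∀ i, 1 ≤ d i) (j : Fin m)
    (D : ℝ≥0) (hD : (Finset.univ.filter fun i => D < d i).card ≤ j) :
    intrinsicCost (anyTarget d hd) ≤ ((2 * ((j + 1 : ℕ) * D) : ℝ≥0) : ℝ≥0∞) := by
  set σ : Strategy m := fun h => (Fin.ofNat m h.length, D) with hσ
  refine iInf_le_of_le σ (iSup_le fun π => ?_)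
  set J := (anyTarget d hd).present π with hJ
  -- Pigeonhole: rays `0, …, j` carry `j + 1` targets, too many to lie all beyond `D`.
  obtain ⟨r, hrj, hr⟩ : ∃ r ≤ j, d (π r) ≤ D := by
    by_contra! hcon
    have : (Finset.Iic j).card ≤ (Finset.univ.filter fun i => D < d i).card :=
      Finset.card_le_card_of_injOn π (fun r hr => by simpa using hcon r (by simpa using hr))
        π.injective.injOn
    rw [Fin.card_Iic] at this
    omega
  have hcl : History.Cleared (run σ J (r + 1)) r := by
    by_cases hc : History.Cleared (run σ J r) r
    · exact Cleared.mono_run (Nat.le_succ _) hc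
    · have e : (σ (run σ J r)).1 = r := by
        simp only [hσ, length_run]
        ext
        simp
      have hd : J.d (σ (run σ J r)).1 ≤ target σ (run σ J r) := by
        rw [target, e, if_neg hc]
        exact ENNReal.coe_le_coe.2 hr
      exact (cleared_found hd r).2 (Or.inl e.symm)
  have hcl' : History.Cleared (run σ J (j + 1)) r :=
    Cleared.mono_run (Nat.succ_le_succ hrj) hcl
  refine (iInf₂_le ((j : ℕ) + 1) ?_).trans (ENNReal.coe_le_coe.2 ?_)
  · rw [(faithful_run σ J _).gathered]
    exact Finset.single_le_sum (f := fun i => J.w i) (fun _ _ => zero_le)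
      (Finset.mem_filter.2 ⟨Finset.mem_univ r, hcl'⟩)
  · refine (elapsed_le_two_mul_effort _).trans ?_
    gcongr
    exact effort_run_le (σ := σ) (fun _ => le_rfl) _

/-- Among nonnegative numbers with sum at most `T`, for some `j` at most `j` of them exceed
`T / ((j + 1) * H_m)`. -/
theorem exists_harmonic_rank (hm : 0 < m) (y : Fin m → ℝ≥0) (T : ℝ) (hT : ∑ i, (y i : ℝ) ≤ T) :
    ∃ j i₀ : Fin m, (Finset.univ.filter fun i => y i₀ < y i).card ≤ j ∧
      ((j : ℝ) + 1) * y i₀ * harmonic m ≤ T := by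
  have Hpos : (0 : ℝ) < harmonic m := by exact_mod_cast harmonic_pos hm.ne'
  -- `g` lists the indices by decreasing value. If every rank failed, the harmonic sum of the
  -- thresholds would make the total exceed `T`.
  set g : Fin m → Fin m := fun j => Tuple.sort y j.rev with hg
  have anti : ∀ j j' : Fin m, j ≤ j' → y (g j') ≤ y (g j) := fun j j' h =>
    Tuple.monotone_sort y (Fin.rev_le_rev.2 h)
  obtain ⟨j, hj⟩ : ∃ j : Fin m, ((j : ℝ) + 1) * y (g j) * harmonic m ≤ T := by
    by_contra! hcon
    have : Nonempty (Fin m) := ⟨⟨0, hm⟩⟩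
    have h1 : ∑ j : Fin m, T / harmonic m * ((j : ℝ) + 1)⁻¹ < ∑ j, (y (g j) : ℝ) := by
      refine Finset.sum_lt_sum_of_nonempty Finset.univ_nonempty fun j _ => ?_
      have := hcon j
      have hj : (0 : ℝ) < (j : ℝ) + 1 := by positivity
      rw [← div_eq_mul_inv, div_div, div_lt_iff₀ (by positivity)]
      linarith
    have h2 : ∑ j : Fin m, ((j : ℝ) + 1)⁻¹ = harmonic m := by
      rw [Fin.sum_univ_eq_sum_range (fun j : ℕ => ((j : ℝ) + 1)⁻¹)]
      simp [harmonic]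
    have h3 : ∑ j, (y (g j) : ℝ) = ∑ i, (y i : ℝ) :=
      Equiv.sum_comp (Fin.revPerm.trans (Tuple.sort y)) fun i => (y i : ℝ)
    rw [← Finset.mul_sum, h2, div_mul_cancel₀ _ Hpos.ne', h3] at h1
    linarith
  refine ⟨j, g j, ?_, hj⟩
  rw [← Fin.card_Iio j]
  refine Finset.card_le_card_of_injOn (fun i => ((Tuple.sort y).symm i).rev) (fun i hi => ?_)
    (Fin.rev_injective.comp (Tuple.sort y).symm.injective).injOn
  simp only [Finset.coe_filter, Finset.mem_univ, true_and, Set.mem_ofPred_eq] at hi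
  simp only [Finset.coe_Iio, Set.mem_Iio]
  by_contra! hle
  have := anti _ _ hle
  simp only [hg, Fin.rev_rev, Equiv.apply_symm_apply] at this
  exact absurd hi this.not_gt

theorem competitiveRatio_ge [NeZero m] (A : Algorithm m) :
    ENNReal.ofReal (1 / 4 * Real.log m) ≤ competitiveRatio A := by
  have hm : 0 < m := Nat.pos_of_ne_zero (NeZero.ne m)
  have Hpos : (0 : ℝ) < harmonic m := by exact_mod_cast harmonic_pos hm.ne'
  have hlog : Real.log m ≤ harmonic m := by
    refine le_trans (Real.log_le_log (by exact_mod_cast hm) ?_) (log_add_one_le_harmonic m)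
    push_cast
    linarith
  -- With effort at least `m * H_m`, the additive 1 in the target distances costs the offline sweep
  -- no more than the main term.
  by_cases hex : ∃ n, m * (harmonic m : ℝ) ≤ (run (A 1) (blank m) n).effort
  · obtain ⟨n, hn⟩ := hex
    set h := run (A 1) (blank m) n with hh
    have hd : ∀ i, 1 ≤ h.reach i + 1 := fun i => le_add_self
    have hcost := le_cost_anyTarget (σ := A 1) (n := n) hd fun r =>
      lt_add_of_pos_right _ one_pos
    obtain ⟨j, i₀, hj, hT⟩ := exists_harmonic_rank hm h.reach h.effort (by
      exact_mod_cast sum_reach_le_effort h)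
    have hint := intrinsicCost_anyTarget_le hd j (h.reach i₀ + 1) (by simpa using hj)
    refine le_trans ?_ (le_iSup (fun I => cost (A I.W) I / intrinsicCost I)
      (anyTarget (fun i => h.reach i + 1) hd))
    refine le_trans ?_ (ENNReal.div_le_div hcost hint)
    have hDpos : (0 : ℝ≥0) < 2 * ((j + 1 : ℕ) * (h.reach i₀ + 1)) := by positivity
    rw [← ENNReal.coe_div hDpos.ne', ENNReal.ofReal, ENNReal.coe_le_coe,
      Real.toNNReal_le_iff_le_coe]
    push_cast
    rw [le_div_iff₀ (by positivity)]
    have hjm : (j : ℝ) + 1 ≤ m := by exact_mod_cast j.2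
    have e1 : ((j : ℝ) + 1) * harmonic m ≤ h.effort :=
      (mul_le_mul_of_nonneg_right hjm Hpos.le).trans hn
    calc 1 / 4 * Real.log m * (2 * (((j : ℝ) + 1) * (h.reach i₀ + 1)))
        ≤ 1 / 4 * harmonic m * (2 * (((j : ℝ) + 1) * (h.reach i₀ + 1))) := by gcongr
      _ = 1 / 2 * (((j : ℝ) + 1) * h.reach i₀ * harmonic m + ((j : ℝ) + 1) * harmonic m) := by
          ring
      _ ≤ _ := by linarith
  -- The effort may stay bounded forever, since depths can be arbitrarily small; targets beyond the
  -- bound are then never found.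
  · push Not at hex
    obtain ⟨M, hM⟩ := exists_nat_gt (m * (harmonic m : ℝ))
    have hd : ∀ i : Fin m, (1 : ℝ≥0) ≤ (M : ℝ≥0) + 1 := fun _ => le_add_self
    have hlt : ∀ n r, (run (A 1) (blank m) n).reach r < (M : ℝ≥0) + 1 := fun n r => by
      refine (reach_le_effort _ r).trans_lt ?_
      rw [← NNReal.coe_lt_coe]
      push_cast
      linarith [hex n]
    have hcost : cost (A 1) (anyTarget (fun _ => (M : ℝ≥0) + 1) hd) = ⊤ := by
      refine le_antisymm le_top (le_iInf₂ fun k hk => ?_)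
      rw [run_anyTarget hd (hlt k) k le_rfl, gathered_blank] at hk
      exact absurd hk (not_le.2 (zero_lt_one (α := ℝ≥0)))
    have hint := intrinsicCost_anyTarget_le hd ⟨0, hm⟩ (M + 1) (by simp)
    refine le_trans ?_ (le_iSup (fun I => cost (A I.W) I / intrinsicCost I)
      (anyTarget (fun _ => (M : ℝ≥0) + 1) hd))
    change _ ≤ cost (A 1) _ / _
    rw [hcost, ENNReal.top_div_of_ne_top (ne_top_of_le_ne_top ENNReal.coe_ne_top hint)]
    exact le_top

theorem dovetail_isCompetitive [NeZero m] (hm : 2 ≤ m) :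
    IsCompetitive (fun _ => (dovetail : Strategy m)) (1000 * Real.log m) := by
  -- With `L = Nat.log 2 m + 1` the factor is `192 * Nat.log 2 m + 288`. As `m ≥ 2`, it is at most
  -- `(480 / 0.69) * log m`, below `1000 * log m`.
  have h2 : (0.69 : ℝ) < Real.log 2 := by linarith [Real.log_two_gt_d9]
  have hlog : Real.log 2 ≤ Real.log m := Real.log_le_log two_pos (by exact_mod_cast hm)
  refine ⟨by linarith, fun I => ?_⟩
  refine (cost_dovetail_le_mul (Nat.lt_pow_succ_log_self one_lt_two m).le I).trans ?_
  gcongr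
  rw [ENNReal.le_ofReal_iff_toReal_le ENNReal.coe_ne_top (by linarith), ENNReal.coe_toReal]
  have hL : (Nat.log 2 m : ℝ) * Real.log 2 ≤ Real.log m := by
    rw [← Real.log_pow]
    refine Real.log_le_log (by positivity) ?_
    exact_mod_cast Nat.pow_log_le_self 2 (by omega)
  have hL' : (Nat.log 2 m : ℝ) * 0.69 ≤ Real.log m :=
    (mul_le_mul_of_nonneg_left h2.le (Nat.cast_nonneg _)).trans hL
  push_cast
  linarith

end WeightedSearch

end

theorem theorem4 :
    ∃ c C : ℝ, 0 < c ∧ 0 < C ∧ ∀ m : ℕ, 2 ≤ m →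
      (∃ σ : WeightedSearch.Strategy m,
        WeightedSearch.IsCompetitive (fun _ => σ) (C * Real.log m)) ∧
      (∀ A : WeightedSearch.Algorithm m,
        ENNReal.ofReal (c * Real.log m) ≤ WeightedSearch.competitiveRatio A) := by
  refine ⟨1 / 4, 1000, by norm_num, by norm_num, fun m hm => ?_⟩
  have : NeZero m := ⟨by omega⟩
  exact ⟨⟨_, WeightedSearch.dovetail_isCompetitive hm⟩, WeightedSearch.competitiveRatio_ge⟩
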